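/- Let $D=\{z\in\mathbb C:|z|\le 1\}$. A sequence $E=(e_k)_{k\ge 0}$ in $D$ is a Leja sequence for $D$ if $e_0=1$ and, for every $j\ge 1$, $$\prod_{m=0}^{j-1}|e_j-e_m|=\max_{z\in D}\prod_{m=0}^{j-1}|z-e_m|.$$ A sequence $X=(x_k)_{k\ge 0}$ in $[-1,1]$ is an $\Re$-Leja sequence if there is a Leja sequence $E$ for $D$ such that $X$ is obtained from $(\Re e_k)_{k\ge 0}$ by eliminating repeated values (keeping the first occurrence of each value, in order). For a finite set $A\subset[-1,1]$, let $\Delta(A)$ denote its Lebesgue constant, that is, the norm of the Lagrange interpolation operator $$f\mapsto \sum_{a\in A} f(a)\prod_{b\in A,\,b\ne a}\frac{\cdot-b}{a-b}$$ on $C([-1,1])$ with the maximum norm. Theorem 4.3. There is a constant $M'$ such that for every $\Re$-Leja sequence $X=(x_k)_{k\ge 0}$ and all natural numbers $n,k$ with $2^n+1<k\le 2^{n+1}$, the set $B=\{x_{2^n+1},\dots,x_{k-1}\}$ satisfies $$\Delta(B)\le M'\,2^{2n}\log 2^n .$$ -/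

import Mathlib

noncomputable section

/-- A Leja sequence for the closed unit disk: `e 0 = 1`, all points lie in the disk, and every
later entry maximizes over the disk the product of the distances to the previous entries. -/
def IsLejaSequence (e : ℕ → ℂ) : Prop :=
  e 0 = 1 ∧
    ∀ j : ℕ, 1 ≤ j →
      e j ∈ Metric.closedBall (0 : ℂ) 1 ∧
        IsMaxOn (fun z : ℂ => ∏ m ∈ Finset.range j, ‖z - e m‖) (Metric.closedBall (0 : ℂ) 1) (e j)

/-- `x` is the sequence obtained from `s` by eliminating repeated values: it lists, in order,
the entries of `s` at exactly those indices where a value occurs for the first time. -/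
def IsDedup {α : Type*} (s x : ℕ → α) : Prop :=
  ∃ φ : ℕ → ℕ, StrictMono φ ∧ Set.range φ = {j : ℕ | ∀ i < j, s i ≠ s j} ∧ ∀ k, x k = s (φ k)

/-- A sequence in `[-1,1]` is an `ℜ`-Leja sequence if it is obtained by eliminating repeated
values from the real parts of a Leja sequence for the unit disk. -/
def IsReLejaSequence (x : ℕ → Set.Icc (-1 : ℝ) 1) : Prop :=
  ∃ e : ℕ → ℂ, IsLejaSequence e ∧ IsDedup (fun k => (e k).re) (fun k => (x k : ℝ))

/-- The set of entries of `X(i:j) = (x_i, …, x_j)` (both ends included). -/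
def tupleSet {α : Type*} [DecidableEq α] (x : ℕ → α) (i j : ℕ) : Finset α :=
  (Finset.Icc i j).image x

/-- Lagrange interpolation at the points of `A ⊆ K` as a bounded operator on `C(K)`:
`f ↦ ∑ a ∈ A, f a • ℓ(A, a; ·)`. -/
def lagrangeOperator (K : Set ℝ) [CompactSpace K] (A : Finset K) : C(K, ℝ) →L[ℝ] C(K, ℝ) :=
  ∑ a ∈ A, (ContinuousMap.evalCLM ℝ a).smulRight
    ((Lagrange.basis A (fun b : K => (b : ℝ)) a).toContinuousMapOn K)

/-- The Lebesgue constant `Δ(A, K)`: the norm of the Lagrange interpolation operator on `C(K)`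
with the maximum norm. -/
def lebesgueConstant (K : Set ℝ) [CompactSpace K] (A : Finset K) : ℝ :=
  ‖lagrangeOperator K A‖

end

open Finset

/-! The first `2 ^ n` points of a Leja sequence are the `2 ^ n`-th roots of unity, and the next `2 ^
n` are `ρ * u j` with `ρ ^ 2 ^ n = -1` and `u` again a Leja section. Among the points with indices
from `2 ^ (n + 1)` up to `2 ^ (n + 2)`, exactly the first `2 ^ n` have new real parts. Hence the
nodes of `B` are `(ρ * u j).re` for `j < m`, where `m ≤ 2 ^ n` and `ρ ^ 2 ^ (n + 1) = -1`.

On the unit circle `|z.re - w.re|` is half the product of the distances from `w` to `z` and to its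
conjugate. A Lagrange basis function thus becomes a quotient of four products over a partial
section. Completing the denominators to full sections, whose products are known exactly, replaces
division by multiplication with complementary products (`IsLejaSection.prod_erase_div_le`). The
resulting sum is bounded by dyadic recursion (`IsLejaSection.sum_prod_erase_mul_prod_compl_le`), fed
by the logarithmic Lebesgue function of the roots of unity. This gives `2 * 4 ^ n * (3 + n)`, of the
required order. -/

/-! ### Leja sections of the disk. -/

/-- The first `N` terms of a Leja sequence for the closed unit disk. -/
def IsLejaSection (e : ℕ → ℂ) (N : ℕ) : Prop :=
  e 0 = 1 ∧
    ∀ j : ℕ, 1 ≤ j → j < N →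
      e j ∈ Metric.closedBall (0 : ℂ) 1 ∧
        IsMaxOn (fun z : ℂ => ∏ m ∈ range j, ‖z - e m‖) (Metric.closedBall (0 : ℂ) 1) (e j)

theorem IsLejaSequence.isLejaSection {e : ℕ → ℂ} (h : IsLejaSequence e) (N : ℕ) :
    IsLejaSection e N :=
  ⟨h.1, fun j hj _ => h.2 j hj⟩

theorem IsLejaSection.mono {e : ℕ → ℂ} {M N : ℕ} (h : IsLejaSection e N) (hMN : M ≤ N) :
    IsLejaSection e M :=
  ⟨h.1, fun j hj hjM => h.2 j hj (hjM.trans_le hMN)⟩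

theorem IsLejaSection.congr {e v : ℕ → ℂ} {N : ℕ} (h : IsLejaSection e N) (hN : 1 ≤ N)
    (hv : ∀ i < N, v i = e i) : IsLejaSection v N := by
  refine ⟨by rw [hv 0 hN, h.1], fun j hj hjN => ?_⟩
  have key : (fun z : ℂ => ∏ m ∈ range j, ‖z - v m‖) = fun z : ℂ => ∏ m ∈ range j, ‖z - e m‖ := by
    funext z
    exact prod_congr rfl fun m hm => by rw [hv m ((mem_range.1 hm).trans hjN)]
  rw [key, hv j hjN]
  exact h.2 j hj hjN

/-- Compactness of the disk supplies each further maximizer. The extension serves as a competitor in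
`IsLejaSection.second_half_aux`. -/
theorem IsLejaSection.exists_extend {e : ℕ → ℂ} {j : ℕ} (h : IsLejaSection e j) (hj : 1 ≤ j)
    (k : ℕ) : ∃ v : ℕ → ℂ, (∀ i < j, v i = e i) ∧ IsLejaSection v (j + k) := by
  induction k with
  | zero => exact ⟨e, fun _ _ => rfl, h⟩
  | succ k ih =>
    obtain ⟨v, hve, hv⟩ := ih
    obtain ⟨w, hw, hmax⟩ := (isCompact_closedBall (0 : ℂ) 1).exists_isMaxOn
      ⟨0, by simp⟩ (f := fun z : ℂ => ∏ m ∈ range (j + k), ‖z - v m‖)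
      (by fun_prop)
    have hlt : ∀ i < j + k, Function.update v (j + k) w i = v i := fun i hi =>
      Function.update_of_ne hi.ne _ _
    refine ⟨Function.update v (j + k) w, fun i hi => ?_, ?_, fun i hi hik => ?_⟩
    · rw [hlt i (by omega), hve i hi]
    · rw [hlt 0 (by omega), hv.1]
    · rcases (show i < j + k ∨ i = j + k by omega) with h1 | rfl
      · exact (hv.congr (by omega) hlt).2 i hi h1
      · rw [Function.update_self]
        have key : (fun z : ℂ => ∏ m ∈ range (j + k), ‖z - Function.update v (j + k) w m‖) =
            fun z : ℂ => ∏ m ∈ range (j + k), ‖z - v m‖ := by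
          funext z
          exact prod_congr rfl fun m hm => by rw [hlt m (mem_range.1 hm)]
        rw [key]
        exact ⟨hw, hmax⟩

/-! ### Dyadic sections and roots of unity. -/

theorem Complex.eq_neg_one_of_two_le_norm_sub_one {a : ℂ} (ha : ‖a‖ ≤ 1) (h : 2 ≤ ‖a - 1‖) :
    a = -1 := by
  have h1 : a.re * a.re + a.im * a.im ≤ 1 := by
    have := Complex.sq_norm a
    rw [Complex.normSq_apply] at this
    nlinarith [norm_nonneg a]
  have h2 : 4 ≤ (a.re - 1) * (a.re - 1) + a.im * a.im := by
    have := Complex.sq_norm (a - 1)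
    rw [Complex.normSq_apply] at this
    simp only [Complex.sub_re, Complex.one_re, Complex.sub_im, Complex.one_im, sub_zero] at this
    nlinarith
  have h3 : a.re = -1 := by nlinarith [mul_self_nonneg a.im, mul_self_nonneg (a.re + 1)]
  have h4 : a.im = 0 := by
    rw [h3] at h1
    exact mul_self_eq_zero.1 (by nlinarith [mul_self_nonneg a.im])
  exact Complex.ext (by simp [h3]) (by simp [h4])

theorem Complex.exists_pow_eq_neg_one {M : ℕ} (hM : M ≠ 0) : ∃ z : ℂ, ‖z‖ = 1 ∧ z ^ M = -1 := by
  refine ⟨Complex.exp ((Real.pi / M : ℝ) * Complex.I), Complex.norm_exp_ofReal_mul_I _, ?_⟩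
  rw [← Complex.exp_nat_mul, ← Complex.exp_pi_mul_I]
  congr 1
  have : (M : ℂ) ≠ 0 := by exact_mod_cast hM
  push_cast
  field_simp

theorem prod_sub_mul_left {ρ : ℂ} (hρ : ‖ρ‖ = 1) (z : ℂ) (u : ℕ → ℂ) (s : Finset ℕ) :
    ∏ i ∈ s, ‖ρ * z - ρ * u i‖ = ∏ i ∈ s, ‖z - u i‖ :=
  prod_congr rfl fun i _ => by rw [← mul_sub, norm_mul, hρ, one_mul]

theorem norm_sub_one_le_two {a : ℂ} (ha : ‖a‖ ≤ 1) : ‖a - 1‖ ≤ 2 := by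
  have := norm_sub_le a 1
  rw [norm_one] at this
  linarith

/-- If every section of length `2 ^ n` consists of the roots of unity, then the second half of a
section of length `2 ^ (n + 1)` is a rotated section. -/
theorem IsLejaSection.second_half_aux {n : ℕ}
    (ih : ∀ u, IsLejaSection u (2 ^ n) → ∀ z : ℂ, ∏ i ∈ range (2 ^ n), (z - u i) = z ^ 2 ^ n - 1)
    {e : ℕ → ℂ} (h : IsLejaSection e (2 ^ (n + 1))) :
    ∃ (ρ : ℂ) (u : ℕ → ℂ), ‖ρ‖ = 1 ∧ ρ ^ 2 ^ n = -1 ∧ IsLejaSection u (2 ^ n) ∧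
      ∀ j, e (2 ^ n + j) = ρ * u j := by
  set M := 2 ^ n with hM
  have hMpos : 0 < M := by positivity
  have hM2 : 2 ^ (n + 1) = M + M := by rw [pow_succ, hM]; ring
  rw [hM2] at h
  have hfirst := ih e (h.mono (by omega))
  have hfirst' : ∀ z : ℂ, ∏ i ∈ range M, ‖z - e i‖ = ‖z ^ M - 1‖ := fun z => by
    rw [← norm_prod, hfirst]
  -- The point `e M` maximizes `‖z ^ M - 1‖`, whose maximum on the disk is 2, attained only where `z
  -- ^ M = -1`.
  have hρ : e M ^ M = -1 := by
    obtain ⟨hD, hmax⟩ := h.2 M hMpos (by omega)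
    obtain ⟨z, hz, hz'⟩ := Complex.exists_pow_eq_neg_one hMpos.ne'
    have := hmax (show z ∈ Metric.closedBall (0 : ℂ) 1 by simp [hz])
    simp only [Set.mem_ofPred_eq, hfirst', hz'] at this
    refine Complex.eq_neg_one_of_two_le_norm_sub_one ?_ (le_trans (by norm_num) this)
    rw [norm_pow]
    exact pow_le_one₀ (norm_nonneg _) (by simpa using hD)
  have hρn : ‖e M‖ = 1 := by
    have := congrArg norm hρ
    rw [norm_pow, norm_neg, norm_one] at this
    exact (pow_eq_one_iff_of_nonneg (norm_nonneg _) hMpos.ne').1 this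
  have hρ0 : e M ≠ 0 := by rw [← norm_ne_zero_iff, hρn]; exact one_ne_zero
  have heu : ∀ j, e (M + j) = e M * (e (M + j) / e M) := fun j => by field_simp
  refine ⟨e M, fun j => e (M + j) / e M, hρn, hρ, ?_, heu⟩
  generalize hu : (fun j => e (M + j) / e M) = u at *
  replace heu : ∀ j, e (M + j) = e M * u j := fun j => by rw [heu j, ← hu]
  suffices H : ∀ j, j + 1 ≤ M → IsLejaSection u (j + 1) by
    obtain ⟨k, hk⟩ := Nat.exists_eq_add_of_lt hMpos
    rw [show M = k + 1 by omega]
    exact H k (by omega)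
  intro j
  induction j with
  | zero =>
    intro _
    refine ⟨?_, fun j h1 h2 => by omega⟩
    rw [← hu]
    exact div_self hρ0
  | succ j ihj =>
    intro hj
    have hsec := ihj (by omega)
    -- Competitor: `v (j + 1)` maximizes the product over the rotated points, and it is an `M`-th
    -- root of unity. So `e M * v (j + 1)` also gives the first-half factor its maximum 2, and
    -- maximality of `e` forces `u (j + 1)` to do as well as `v (j + 1)`.
    obtain ⟨v, hvu, hv⟩ := hsec.exists_extend (by omega) (M - (j + 1))
    rw [show j + 1 + (M - (j + 1)) = M by omega] at hv
    have hroot : v (j + 1) ^ M = 1 := by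
      have := ih v hv (v (j + 1))
      rw [prod_eq_zero (mem_range.2 (show j + 1 < M by omega)) (sub_self _)] at this
      exact (sub_eq_zero.1 this.symm)
    obtain ⟨hvD, hvmax⟩ := hv.2 (j + 1) (by omega) (by omega)
    have key : (fun z : ℂ => ∏ m ∈ range (j + 1), ‖z - v m‖) =
        fun z : ℂ => ∏ m ∈ range (j + 1), ‖z - u m‖ := by
      funext z
      exact prod_congr rfl fun m hm => by rw [hvu m (mem_range.1 hm)]
    rw [key] at hvmax
    obtain ⟨heD, hemax⟩ := h.2 (M + (j + 1)) (by omega) (by omega)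
    have hsplit : ∀ z : ℂ, ∏ m ∈ range (M + (j + 1)), ‖e M * z - e m‖ =
        ‖z ^ M * (-1) - 1‖ * ∏ m ∈ range (j + 1), ‖z - u m‖ := fun z => by
      rw [prod_range_add, hfirst', mul_pow, hρ, mul_comm (-1 : ℂ)]
      simp only [heu, prod_sub_mul_left hρn]
    have huD : ‖u (j + 1)‖ ≤ 1 := by
      have : ‖e (M + (j + 1))‖ ≤ 1 := by simpa using heD
      rwa [heu, norm_mul, hρn, one_mul] at this
    have hle := hemax (show e M * v (j + 1) ∈ Metric.closedBall (0 : ℂ) 1 by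
      simpa [hρn] using hvD)
    simp only [Set.mem_ofPred_eq] at hle
    rw [heu, hsplit, hsplit, hroot] at hle
    have h2 : ‖u (j + 1) ^ M * (-1) - 1‖ ≤ 2 := norm_sub_one_le_two (by
      rw [mul_neg_one, norm_neg, norm_pow]
      exact pow_le_one₀ (norm_nonneg _) huD)
    have h3 : ‖(1 : ℂ) * (-1) - 1‖ = 2 := by norm_num
    rw [h3] at hle
    have hle2 : ∏ m ∈ range (j + 1), ‖v (j + 1) - u m‖ ≤
        ∏ m ∈ range (j + 1), ‖u (j + 1) - u m‖ := by
      have := mul_le_mul_of_nonneg_right h2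
        (prod_nonneg fun m (_ : m ∈ range (j + 1)) => norm_nonneg (u (j + 1) - u m))
      linarith
    refine ⟨hsec.1, fun i hi hij => ?_⟩
    rcases (show i < j + 1 ∨ i = j + 1 by omega) with h1 | rfl
    · exact hsec.2 i hi h1
    · exact ⟨by simpa using huD, fun z hz => le_trans (hvmax hz) hle2⟩

/-- The first `2 ^ n` points of a Leja sequence are the roots of unity of order `2 ^ n`. -/
theorem IsLejaSection.prod_sub {n : ℕ} {e : ℕ → ℂ} (h : IsLejaSection e (2 ^ n)) (z : ℂ) :
    ∏ i ∈ range (2 ^ n), (z - e i) = z ^ 2 ^ n - 1 := by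
  induction n generalizing e z with
  | zero => simp [h.1]
  | succ n ih =>
    obtain ⟨ρ, u, hρ, hρM, hu, heu⟩ := IsLejaSection.second_half_aux (fun u hu z => ih hu z) h
    have hρ0 : ρ ≠ 0 := by rw [← norm_ne_zero_iff, hρ]; exact one_ne_zero
    rw [show 2 ^ (n + 1) = 2 ^ n + 2 ^ n by ring, prod_range_add,
      ih (h.mono (Nat.pow_le_pow_right (by norm_num) (by omega)))]
    have : ∏ x ∈ range (2 ^ n), (z - e (2 ^ n + x)) =
        ∏ x ∈ range (2 ^ n), (ρ * (z / ρ - u x)) :=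
      prod_congr rfl fun x _ => by rw [heu]; field_simp
    rw [this, prod_mul_distrib, prod_const, card_range, ih hu, mul_sub, ← mul_pow,
      mul_div_cancel₀ _ hρ0, hρM]
    ring

theorem IsLejaSection.second_half {n : ℕ} {e : ℕ → ℂ} (h : IsLejaSection e (2 ^ (n + 1))) :
    ∃ (ρ : ℂ) (u : ℕ → ℂ), ‖ρ‖ = 1 ∧ ρ ^ 2 ^ n = -1 ∧ IsLejaSection u (2 ^ n) ∧
      ∀ j, e (2 ^ n + j) = ρ * u j :=
  IsLejaSection.second_half_aux (fun _ hu z => hu.prod_sub z) h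

theorem IsLejaSection.first_half {n : ℕ} {e : ℕ → ℂ} (h : IsLejaSection e (2 ^ (n + 1))) :
    IsLejaSection e (2 ^ n) :=
  h.mono (Nat.pow_le_pow_right (by norm_num) (by omega))

theorem IsLejaSection.pow_eq_one {n : ℕ} {e : ℕ → ℂ} (h : IsLejaSection e (2 ^ n)) {j : ℕ}
    (hj : j < 2 ^ n) : e j ^ 2 ^ n = 1 := by
  have := h.prod_sub (e j)
  rw [prod_eq_zero (mem_range.2 hj) (sub_self _)] at this
  exact sub_eq_zero.1 this.symm

theorem IsLejaSection.norm_eq_one {n : ℕ} {e : ℕ → ℂ} (h : IsLejaSection e (2 ^ n)) {j : ℕ}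
    (hj : j < 2 ^ n) : ‖e j‖ = 1 := by
  have := congrArg norm (h.pow_eq_one hj)
  rw [norm_pow, norm_one] at this
  exact (pow_eq_one_iff_of_nonneg (norm_nonneg _) (by positivity)).1 this

theorem IsLejaSection.prod_norm_sub {n : ℕ} {e : ℕ → ℂ} (h : IsLejaSection e (2 ^ n)) (z : ℂ) :
    ∏ i ∈ range (2 ^ n), ‖z - e i‖ = ‖z ^ 2 ^ n - 1‖ := by
  rw [← norm_prod, h.prod_sub]

theorem IsLejaSection.prod_norm_sub_le_two {n : ℕ} {e : ℕ → ℂ} (h : IsLejaSection e (2 ^ n))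
    {z : ℂ} (hz : ‖z‖ = 1) : ∏ i ∈ range (2 ^ n), ‖z - e i‖ ≤ 2 := by
  rw [h.prod_norm_sub]
  exact norm_sub_one_le_two (by rw [norm_pow, hz, one_pow])

theorem IsLejaSection.prod_erase {n : ℕ} {u : ℕ → ℂ} (h : IsLejaSection u (2 ^ n)) {j : ℕ}
    (hj : j < 2 ^ n) (z : ℂ) :
    ∏ i ∈ (range (2 ^ n)).erase j, (z - u i) =
      ∑ k ∈ range (2 ^ n), z ^ k * u j ^ (2 ^ n - 1 - k) := by
  -- Cancelling `X - u j` between polynomials, rather than values, keeps the formula valid at `z = u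
  -- j`.
  have hpoly : ∏ i ∈ range (2 ^ n), (Polynomial.X - Polynomial.C (u i)) =
      Polynomial.X ^ 2 ^ n - Polynomial.C (u j) ^ 2 ^ n := by
    refine Polynomial.funext fun x => ?_
    rw [Polynomial.eval_prod]
    simp only [Polynomial.eval_sub, Polynomial.eval_X, Polynomial.eval_C, Polynomial.eval_pow]
    rw [h.prod_sub, h.pow_eq_one hj]
  rw [← mul_prod_erase _ _ (mem_range.2 hj), ← (Commute.all _ _).geom_sum₂_mul, mul_comm] at hpoly
  have := congrArg (Polynomial.eval z)
    (mul_right_cancel₀ (Polynomial.X_sub_C_ne_zero (u j)) hpoly)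
  simpa [Polynomial.eval_prod, Polynomial.eval_finsetSum] using this

theorem IsLejaSection.prod_erase_self {n : ℕ} {u : ℕ → ℂ} (h : IsLejaSection u (2 ^ n)) {j : ℕ}
    (hj : j < 2 ^ n) : ∏ i ∈ (range (2 ^ n)).erase j, ‖u j - u i‖ = 2 ^ n := by
  rw [← norm_prod, h.prod_erase hj]
  have : ∀ k ∈ range (2 ^ n), u j ^ k * u j ^ (2 ^ n - 1 - k) = u j ^ (2 ^ n - 1) := fun k hk => by
    have := mem_range.1 hk
    rw [← pow_add]
    congr 1
    omega
  rw [sum_congr rfl this, sum_const, card_range, nsmul_eq_mul, norm_mul, norm_pow,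
    h.norm_eq_one hj, one_pow, mul_one]
  simp

theorem IsLejaSection.injOn {n : ℕ} {u : ℕ → ℂ} (h : IsLejaSection u (2 ^ n)) :
    Set.InjOn u (range (2 ^ n)) := by
  intro j hj i hi hij
  by_contra hne
  have h1 := h.prod_erase_self (mem_range.1 hj)
  rw [prod_eq_zero (mem_erase.2 ⟨Ne.symm hne, hi⟩) (by rw [hij, sub_self, norm_zero])] at h1
  exact absurd h1 (by positivity)

/-! ### The Lebesgue function of the roots of unity. -/

theorem sum_eq_sum_nthRootsFinset {M : ℕ} (hM : 0 < M) {u : ℕ → ℂ}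
    (hinj : Set.InjOn u (range M)) (hu : ∀ i < M, u i ^ M = 1) (f : ℂ → ℝ) :
    ∑ i ∈ range M, f (u i) = ∑ w ∈ Polynomial.nthRootsFinset M (1 : ℂ), f w := by
  rw [← sum_image (f := f) hinj]
  congr 1
  refine eq_of_subset_of_card_le (fun w hw => ?_) ?_
  · obtain ⟨i, hi, rfl⟩ := mem_image.1 hw
    exact (Polynomial.mem_nthRootsFinset hM (1 : ℂ)).2 (hu i (mem_range.1 hi))
  · rw [card_image_of_injOn hinj, card_range]
    exact (Complex.isPrimitiveRoot_exp M hM.ne').card_nthRootsFinset.le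

/-- Jordan's inequality on the half of `[0, π]` containing the angle, after reflection if needed;
adding the bounds for both halves avoids a case split in the later sum. -/
theorem inv_sin_le {m k : ℕ} (hk : k < m) {δ : ℝ} (h0 : 0 ≤ δ) (h1 : δ < 1) :
    0 < Real.sin (Real.pi * ((k + 2 - δ) / (m + 2))) ∧
    (Real.sin (Real.pi * ((k + 2 - δ) / (m + 2))))⁻¹ ≤
      (m + 2) / 2 * (1 / (k + 1 : ℝ) + 1 / ((m - 1 - k : ℕ) + 1 : ℝ)) := by
  have hcast : ((m - 1 - k : ℕ) : ℝ) + 1 = m - k := by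
    rw [show m - 1 - k = m - (k + 1) by omega, Nat.cast_sub (by omega)]
    push_cast
    ring
  rw [hcast]
  have hkm : (k : ℝ) + 1 ≤ m := by exact_mod_cast hk
  have hk0 : (0 : ℝ) ≤ k := k.cast_nonneg
  have hpi := Real.pi_pos
  have hm : (0 : ℝ) < m + 2 := by linarith
  have aux : ∀ t s : ℝ, 0 < s → s ≤ t → t / (m + 2) ≤ 1 / 2 →
      0 < Real.sin (Real.pi * (t / (m + 2))) ∧
        (Real.sin (Real.pi * (t / (m + 2))))⁻¹ ≤ (m + 2) / 2 * (1 / s) := by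
    intro t s hs hst ht
    have h2 : 0 < 2 * s / (m + 2) := by positivity
    have h3 : 2 * s / (m + 2) ≤ Real.sin (Real.pi * (t / (m + 2))) := by
      have := Real.mul_le_sin (x := Real.pi * (t / (m + 2)))
        (by have : 0 < t := hs.trans_le hst
            positivity) (by nlinarith)
      refine le_trans ?_ this
      rw [show 2 / Real.pi * (Real.pi * (t / (m + 2))) = 2 * t / (m + 2) by field_simp]
      gcongr
    refine ⟨h2.trans_le h3, (inv_anti₀ h2 h3).trans (le_of_eq ?_)⟩
    field_simp
  rcases le_total ((k + 2 - δ) / (m + 2)) (1 / 2) with h | h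
  · obtain ⟨ha, hb⟩ := aux (k + 2 - δ) (k + 1) (by linarith) (by linarith) h
    refine ⟨ha, hb.trans ?_⟩
    have : 0 ≤ 1 / ((m : ℝ) - k) := by
      apply div_nonneg <;> linarith
    gcongr
    linarith
  · have hrefl : Real.pi * ((k + 2 - δ) / (m + 2)) =
        Real.pi - Real.pi * ((m - k + δ) / (m + 2)) := by
      field_simp
      ring
    rw [hrefl, Real.sin_pi_sub]
    have h5 : (m - k + δ) / (m + 2) = 1 - (k + 2 - δ) / (m + 2) := by
      field_simp
      ring
    obtain ⟨ha, hb⟩ := aux (m - k + δ) (m - k) (by linarith) (by linarith) (by linarith)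
    refine ⟨ha, hb.trans ?_⟩
    have : 0 ≤ 1 / ((k : ℝ) + 1) := by positivity
    gcongr
    linarith

theorem norm_geom_sum₂_le {M : ℕ} {z w : ℂ} (hz : ‖z‖ = 1) (hw : ‖w‖ = 1) :
    ‖∑ k ∈ range M, z ^ k * w ^ (M - 1 - k)‖ ≤ M := by
  refine (norm_sum_le _ _).trans ?_
  simp [hz, hw]

theorem norm_geom_sum₂_mul_le {M : ℕ} {z w : ℂ} (hz : ‖z‖ = 1) (hw : ‖w‖ = 1) :
    ‖∑ k ∈ range M, z ^ k * w ^ (M - 1 - k)‖ * ‖z - w‖ ≤ 2 := by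
  rw [← norm_mul, (Commute.all _ _).geom_sum₂_mul]
  refine (norm_sub_le _ _).trans ?_
  rw [norm_pow, norm_pow, hz, hw, one_pow]
  norm_num

theorem sum_one_div_add_one_le (m : ℕ) :
    ∑ k ∈ range m, 1 / (k + 1 : ℝ) ≤ 1 + Real.log m := by
  have := harmonic_le_one_add_log m
  rw [harmonic] at this
  push_cast at this
  simpa [one_div] using this

theorem exists_root_mul_exp {M : ℕ} (hM : 0 < M) {z : ℂ} (hz : ‖z‖ = 1) :
    ∃ (w : ℂ) (δ : ℝ), w ^ M = 1 ∧ 0 ≤ δ ∧ δ < 1 ∧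
      z = w * Complex.exp (Complex.I * (2 * Real.pi * (δ / M) : ℝ)) := by
  have hM' : (M : ℝ) ≠ 0 := by exact_mod_cast hM.ne'
  have hMC : (M : ℂ) ≠ 0 := by exact_mod_cast hM.ne'
  have hpi := Real.pi_ne_zero
  set t : ℝ := M * (z.arg / (2 * Real.pi)) with ht
  refine ⟨Complex.exp (Complex.I * (2 * Real.pi * (⌊t⌋ / M) : ℝ)), Int.fract t, ?_,
    Int.fract_nonneg t, Int.fract_lt_one t, ?_⟩
  · rw [← Complex.exp_nat_mul, Complex.exp_eq_one_iff]
    refine ⟨⌊t⌋, ?_⟩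
    push_cast
    field_simp
  · rw [← Complex.exp_add, ← mul_add, ← Complex.ofReal_add, ← mul_add, ← add_div,
      Int.floor_add_fract, ht]
    have harg : 2 * Real.pi * (M * (z.arg / (2 * Real.pi)) / M) = z.arg := by field_simp
    rw [harg, mul_comm]
    have := Complex.norm_mul_exp_arg_mul_I z
    rw [hz, Complex.ofReal_one, one_mul] at this
    exact this.symm

/-- The Lebesgue function of the roots of unity grows at most logarithmically. -/
theorem sum_norm_geom_sum₂_le {M : ℕ} (hM : 0 < M) {z : ℂ} (hz : ‖z‖ = 1) :
    ∑ w ∈ Polynomial.nthRootsFinset M (1 : ℂ), ‖∑ k ∈ range M, z ^ k * w ^ (M - 1 - k)‖ ≤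
      M * (3 + Real.log M) := by
  obtain ⟨w, δ, hw, hδ0, hδ1, hzw⟩ := exists_root_mul_exp hM hz
  have hprim := Complex.isPrimitiveRoot_exp M hM.ne'
  set ζ := Complex.exp (2 * Real.pi * Complex.I / M) with hζ
  have hw1 : ‖w‖ = 1 := by
    have := congrArg norm hw
    rw [norm_pow, norm_one] at this
    exact (pow_eq_one_iff_of_nonneg (norm_nonneg _) hM.ne').1 this
  have hw0 : w ≠ 0 := by rw [← norm_ne_zero_iff, hw1]; exact one_ne_zero
  have hroot : ∀ i < M, (w * ζ ^ i) ^ M = 1 := fun i _ => by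
    rw [mul_pow, hw, ← pow_mul, mul_comm i, pow_mul, hprim.pow_eq_one, one_pow, one_mul]
  have hζ1 : ‖ζ‖ = 1 := hprim.norm'_eq_one hM.ne'
  have hnorm : ∀ i, ‖w * ζ ^ i‖ = 1 := fun i => by
    rw [norm_mul, norm_pow, hw1, hζ1, one_pow, one_mul]
  rw [← sum_eq_sum_nthRootsFinset hM (u := fun i => w * ζ ^ i)
    (fun i hi j hj hij => hprim.pow_inj (by simpa using hi) (by simpa using hj)
      (mul_left_cancel₀ hw0 hij)) hroot
    (fun w => ‖∑ k ∈ range M, z ^ k * w ^ (M - 1 - k)‖)]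
  have hlogM : 0 ≤ Real.log M := Real.log_natCast_nonneg M
  rcases (show M = 1 ∨ ∃ m, M = m + 2 by
    rcases M with _ | _ | m
    · omega
    · exact Or.inl rfl
    · exact Or.inr ⟨m, rfl⟩) with rfl | ⟨m, hm⟩
  · simp
  have hdist : ∀ k : ℕ, ‖z - w * ζ ^ k‖ =
      2 * |Real.sin (Real.pi * ((k - δ) / M))| := fun k => by
    have h1 : z - w * ζ ^ k = w * ζ ^ k *
        (Complex.exp (Complex.I * (2 * Real.pi * ((δ - k) / M) : ℝ)) - 1) := by
      rw [mul_sub, mul_one, mul_assoc, hζ, ← Complex.exp_nat_mul, ← Complex.exp_add, hzw]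
      congr 3
      push_cast
      ring
    rw [h1, norm_mul, hnorm, one_mul, Complex.norm_exp_I_mul_ofReal_sub_one, norm_mul,
      Real.norm_eq_abs, Real.norm_eq_abs, abs_two,
      show 2 * Real.pi * ((δ - k) / M) / 2 = -(Real.pi * ((k - δ) / M)) by ring, Real.sin_neg,
      abs_neg]
  -- The point `z` lies on the arc from `w` to `w * ζ`. These two nearest roots are set aside and
  -- cost at most `M` each; every other root is controlled by its distance to `z`.
  have hterm : ∀ k ∈ range m,
      ‖∑ l ∈ range M, z ^ l * (w * ζ ^ (k + 1 + 1)) ^ (M - 1 - l)‖ ≤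
        M / 2 * (1 / (k + 1 : ℝ) + 1 / ((m - 1 - k : ℕ) + 1 : ℝ)) := fun k hk => by
    obtain ⟨h1, h2⟩ := inv_sin_le (mem_range.1 hk) hδ0 hδ1
    have h3 := norm_geom_sum₂_mul_le (M := M) hz (hnorm (k + 1 + 1))
    rw [hdist, hm] at h3
    push_cast at h3
    rw [show (k : ℝ) + 1 + 1 - δ = k + 2 - δ by ring, abs_of_pos h1] at h3
    rw [hm]
    push_cast
    refine le_trans ?_ h2
    rw [← one_div, le_div_iff₀ h1]
    linarith
  have hlog : ∑ k ∈ range m, 1 / (k + 1 : ℝ) ≤ 1 + Real.log M := by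
    refine (sum_one_div_add_one_le m).trans ?_
    rcases Nat.eq_zero_or_pos m with rfl | hm0
    · simpa using hlogM
    · have : Real.log m ≤ Real.log M :=
        Real.log_le_log (by exact_mod_cast hm0) (by rw [hm]; push_cast; linarith)
      linarith
  have hsum : ∑ k ∈ range m, (M : ℝ) / 2 * (1 / (k + 1 : ℝ) + 1 / ((m - 1 - k : ℕ) + 1 : ℝ)) ≤
      M * (1 + Real.log M) := by
    rw [← mul_sum, sum_add_distrib, sum_range_reflect (fun k => 1 / ((k : ℝ) + 1)) m]
    have : (0 : ℝ) ≤ M := M.cast_nonneg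
    nlinarith
  have h0 := norm_geom_sum₂_le (M := M) hz (hnorm 0)
  have h1 := norm_geom_sum₂_le (M := M) hz (hnorm (0 + 1))
  have key : ∑ i ∈ range M, ‖∑ k ∈ range M, z ^ k * (w * ζ ^ i) ^ (M - 1 - k)‖ =
      ∑ i ∈ range m, ‖∑ k ∈ range M, z ^ k * (w * ζ ^ (i + 1 + 1)) ^ (M - 1 - k)‖ +
        ‖∑ k ∈ range M, z ^ k * (w * ζ ^ (0 + 1)) ^ (M - 1 - k)‖ +
        ‖∑ k ∈ range M, z ^ k * (w * ζ ^ 0) ^ (M - 1 - k)‖ := by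
    rw [show range M = range (m + 1 + 1) by rw [hm], sum_range_succ', sum_range_succ']
  rw [key]
  have := (sum_le_sum hterm).trans hsum
  linarith

theorem IsLejaSection.sum_prod_erase_le {n : ℕ} {u : ℕ → ℂ} (h : IsLejaSection u (2 ^ n))
    {z : ℂ} (hz : ‖z‖ = 1) :
    ∑ j ∈ range (2 ^ n), ∏ i ∈ (range (2 ^ n)).erase j, ‖z - u i‖ ≤ 2 ^ n * (3 + n) := by
  have h1 : ∀ j ∈ range (2 ^ n), ∏ i ∈ (range (2 ^ n)).erase j, ‖z - u i‖ =
      ‖∑ k ∈ range (2 ^ n), z ^ k * u j ^ (2 ^ n - 1 - k)‖ := fun j hj => by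
    rw [← norm_prod, h.prod_erase (mem_range.1 hj)]
  rw [sum_congr rfl h1, sum_eq_sum_nthRootsFinset (by positivity) h.injOn
    (fun i hi => h.pow_eq_one hi)
    (fun w => ‖∑ k ∈ range (2 ^ n), z ^ k * w ^ (2 ^ n - 1 - k)‖)]
  refine (sum_norm_geom_sum₂_le (by positivity) hz).trans ?_
  push_cast
  have h2 : Real.log (2 ^ n) ≤ n := by
    rw [Real.log_pow]
    exact mul_le_of_le_one_right n.cast_nonneg
      ((Real.log_le_sub_one_of_pos (by norm_num)).trans (by norm_num))
  gcongr

/-! ### Products over partial sections. -/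

theorem prod_norm_sub_rotate {u e : ℕ → ℂ} {ρ : ℂ} (hρ : ‖ρ‖ = 1) {M : ℕ}
    (heu : ∀ j, e (M + j) = ρ * u j) (z : ℂ) (s : Finset ℕ) :
    ∏ i ∈ s, ‖z - e (M + i)‖ = ∏ i ∈ s, ‖z / ρ - u i‖ := by
  have hρ0 : ρ ≠ 0 := by rw [← norm_ne_zero_iff, hρ]; exact one_ne_zero
  rw [← prod_sub_mul_left hρ (z / ρ)]
  exact prod_congr rfl fun i _ => by rw [heu, mul_div_cancel₀ _ hρ0]

theorem prod_Ico_add_left (f : ℕ → ℝ) (M a b : ℕ) :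
    ∏ i ∈ Ico (M + a) (M + b), f i = ∏ i ∈ Ico a b, f (M + i) := by
  rw [add_comm M a, add_comm M b, prod_Ico_add f]

/-- A partial product of a section times the complementary product is at most twice the length. -/
theorem IsLejaSection.prod_mul_prod_compl_le {n : ℕ} {u : ℕ → ℂ} (h : IsLejaSection u (2 ^ n))
    {m : ℕ} (hm : m ≤ 2 ^ n) {z y : ℂ} (hz : ‖z‖ = 1) (hy : ‖y‖ = 1) :
    (∏ i ∈ range m, ‖z - u i‖) * ∏ i ∈ Ico m (2 ^ n), ‖y - u i‖ ≤ 2 * 2 ^ n := by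
  induction n generalizing u m z y with
  | zero =>
    rcases (show m = 0 ∨ m = 1 by omega) with rfl | rfl
    · simpa [h.1] using norm_sub_one_le_two hy.le
    · simpa [h.1] using norm_sub_one_le_two hz.le
  | succ n ih =>
    obtain ⟨ρ, v, hρ, -, hv, huv⟩ := h.second_half
    have hdiv : ∀ {z : ℂ}, ‖z‖ = 1 → ‖z / ρ‖ = 1 := fun hz => by rw [norm_div, hz, hρ, div_one]
    have hM2 : 2 ^ (n + 1) = 2 ^ n + 2 ^ n := by ring
    have hR : (2 : ℝ) * 2 ^ (n + 1) = 2 * 2 ^ n * 2 := by ring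
    rw [hR, hM2]
    -- On either side of the midpoint one of the two halves is complete and contributes a factor at
    -- most 2; the half that is cut at `m` is left to induction.
    rcases le_total m (2 ^ n) with hmn | hmn
    · rw [← prod_Ico_consecutive _ hmn (by omega : 2 ^ n ≤ 2 ^ n + 2 ^ n), ← mul_assoc]
      refine mul_le_mul (ih h.first_half hmn hz hy) ?_ (prod_nonneg fun _ _ => norm_nonneg _)
        (by positivity)
      have := prod_Ico_add_left (fun i => ‖y - u i‖) (2 ^ n) 0 (2 ^ n)
      rw [add_zero] at this
      rw [this, prod_norm_sub_rotate hρ huv, ← range_eq_Ico]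
      exact hv.prod_norm_sub_le_two (hdiv hy)
    · obtain ⟨k, rfl⟩ := Nat.exists_eq_add_of_le hmn
      rw [prod_range_add, prod_Ico_add_left (fun i => ‖y - u i‖),
        prod_norm_sub_rotate hρ huv,
        prod_norm_sub_rotate hρ huv, mul_assoc, mul_comm (2 * 2 ^ n : ℝ)]
      exact mul_le_mul (h.first_half.prod_norm_sub_le_two hz)
        (ih hv (by omega) (hdiv hz) (hdiv hy))
        (mul_nonneg (prod_nonneg fun _ _ => norm_nonneg _) (prod_nonneg fun _ _ => norm_nonneg _))
        (by norm_num)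

theorem prod_range_add_erase_left (f : ℕ → ℝ) {M k j : ℕ} (hj : j < M) :
    ∏ i ∈ (range (M + k)).erase j, f i =
      (∏ i ∈ (range M).erase j, f i) * ∏ i ∈ range k, f (M + i) := by
  have h1 : (range (M + k)).erase j = (range M).erase j ∪ Ico M (M + k) := by
    ext i
    simp only [mem_erase, mem_range, mem_union, mem_Ico]
    omega
  rw [h1, prod_union, prod_Ico_eq_prod_range]
  · simp
  · rw [disjoint_left]
    simp only [mem_erase, mem_range, mem_Ico]
    omega

theorem prod_range_add_erase_right (f : ℕ → ℝ) {M k j : ℕ} :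
    ∏ i ∈ (range (M + k)).erase (M + j), f i =
      (∏ i ∈ range M, f i) * ∏ i ∈ (range k).erase j, f (M + i) := by
  have h1 : (range (M + k)).erase (M + j) =
      range M ∪ ((range k).erase j).map (addLeftEmbedding M) := by
    ext i
    simp only [mem_erase, mem_range, mem_union, mem_map, addLeftEmbedding_apply]
    constructor
    · intro h
      rcases lt_or_ge i M with h1 | h1
      · exact Or.inl h1
      · exact Or.inr ⟨i - M, by omega, by omega⟩
    · rintro (h | ⟨a, h, rfl⟩) <;> omega
  rw [h1, prod_union, prod_map]
  · simp
  · rw [disjoint_left]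
    simp only [mem_range, mem_map, addLeftEmbedding_apply, mem_erase]
    rintro i hi ⟨a, -, rfl⟩
    omega

/-- Induction on the dyadic length. If `m` passes the midpoint, indices in the first half see a full
set of roots of unity, with Lebesgue sum at most `2 ^ n * (3 + n)`, times a mixed product at most `2
* 2 ^ n`; indices in the second half reproduce the sum one level down, times 2. The point `y j` may
vary with `j` because the application uses the reflection of the `j`-th node. -/
theorem IsLejaSection.sum_prod_erase_mul_prod_compl_le {n : ℕ} {u : ℕ → ℂ}
    (h : IsLejaSection u (2 ^ n)) {m : ℕ} (hm : m ≤ 2 ^ n) {z : ℂ} {y : ℕ → ℂ} (hz : ‖z‖ = 1)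
    (hy : ∀ j, ‖y j‖ = 1) :
    ∑ j ∈ range m, (∏ i ∈ (range m).erase j, ‖z - u i‖) * ∏ i ∈ Ico m (2 ^ n), ‖y j - u i‖ ≤
      4 ^ n * (3 + n) := by
  induction n generalizing u m z y with
  | zero =>
    rcases (show m = 0 ∨ m = 1 by omega) with rfl | rfl
    · simp
    · simp
  | succ n ih =>
    obtain ⟨ρ, v, hρ, -, hv, huv⟩ := h.second_half
    have hdiv : ∀ {z : ℂ}, ‖z‖ = 1 → ‖z / ρ‖ = 1 := fun hz => by rw [norm_div, hz, hρ, div_one]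
    have hM2 : 2 ^ (n + 1) = 2 ^ n + 2 ^ n := by ring
    have hn : (0 : ℝ) ≤ n := n.cast_nonneg
    have hnn : ∀ (z : ℂ) (w : ℕ → ℂ) (s : Finset ℕ), 0 ≤ ∏ i ∈ s, ‖z - w i‖ :=
      fun z w s => prod_nonneg fun _ _ => norm_nonneg _
    have h4 : (0 : ℝ) < 4 ^ n := by positivity
    rw [hM2]
    rcases le_total m (2 ^ n) with hmn | hmn
    · have hterm : ∀ j ∈ range m, (∏ i ∈ (range m).erase j, ‖z - u i‖) *
          ∏ i ∈ Ico m (2 ^ n + 2 ^ n), ‖y j - u i‖ ≤ ((∏ i ∈ (range m).erase j, ‖z - u i‖) *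
            ∏ i ∈ Ico m (2 ^ n), ‖y j - u i‖) * 2 := fun j _ => by
        rw [← prod_Ico_consecutive _ hmn (by omega : 2 ^ n ≤ 2 ^ n + 2 ^ n), ← mul_assoc]
        refine mul_le_mul_of_nonneg_left ?_ (mul_nonneg (hnn _ _ _) (hnn _ _ _))
        have := prod_Ico_add_left (fun i => ‖y j - u i‖) (2 ^ n) 0 (2 ^ n)
        rw [add_zero] at this
        rw [this, prod_norm_sub_rotate hρ huv, ← range_eq_Ico]
        exact hv.prod_norm_sub_le_two (hdiv (hy j))
      refine (sum_le_sum hterm).trans ?_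
      rw [← sum_mul, pow_succ]
      have := ih h.first_half hmn hz hy
      push_cast
      nlinarith
    · obtain ⟨k, rfl⟩ := Nat.exists_eq_add_of_le hmn
      rw [sum_range_add]
      have hcompl : ∀ j, ∏ i ∈ Ico (2 ^ n + k) (2 ^ n + 2 ^ n), ‖y j - u i‖ =
          ∏ i ∈ Ico k (2 ^ n), ‖y j / ρ - v i‖ := fun j => by
        rw [prod_Ico_add_left (fun i => ‖y j - u i‖),
          prod_norm_sub_rotate hρ huv]
      have h1 : ∀ j ∈ range (2 ^ n), (∏ i ∈ (range (2 ^ n + k)).erase j, ‖z - u i‖) *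
          ∏ i ∈ Ico (2 ^ n + k) (2 ^ n + 2 ^ n), ‖y j - u i‖ ≤
            (∏ i ∈ (range (2 ^ n)).erase j, ‖z - u i‖) * (2 * 2 ^ n) := fun j hj => by
        rw [hcompl, prod_range_add_erase_left (fun i => ‖z - u i‖) (mem_range.1 hj),
          prod_norm_sub_rotate hρ huv, mul_assoc]
        exact mul_le_mul_of_nonneg_left
          (hv.prod_mul_prod_compl_le (by omega) (hdiv hz) (hdiv (hy j))) (hnn _ _ _)
      have h2 : ∀ j ∈ range k, (∏ i ∈ (range (2 ^ n + k)).erase (2 ^ n + j), ‖z - u i‖) *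
          ∏ i ∈ Ico (2 ^ n + k) (2 ^ n + 2 ^ n), ‖y (2 ^ n + j) - u i‖ ≤
            2 * ((∏ i ∈ (range k).erase j, ‖z / ρ - v i‖) *
              ∏ i ∈ Ico k (2 ^ n), ‖y (2 ^ n + j) / ρ - v i‖) := fun j _ => by
        rw [hcompl, prod_range_add_erase_right (fun i => ‖z - u i‖),
          prod_norm_sub_rotate hρ huv, mul_assoc]
        exact mul_le_mul_of_nonneg_right (h.first_half.prod_norm_sub_le_two hz)
          (mul_nonneg (hnn _ _ _) (hnn _ _ _))
      refine (add_le_add (sum_le_sum h1) (sum_le_sum h2)).trans ?_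
      rw [← sum_mul, ← mul_sum]
      have h3 := ih hv (m := k) (by omega) (hdiv hz) (y := fun j => y (2 ^ n + j) / ρ)
        (fun j => hdiv (hy _))
      have h5 := mul_le_mul_of_nonneg_right (h.first_half.sum_prod_erase_le hz)
        (by positivity : (0 : ℝ) ≤ 2 * 2 ^ n)
      have h6 : (2 : ℝ) ^ n * (3 + n) * (2 * 2 ^ n) = 2 * (4 ^ n * (3 + n)) := by
        rw [show (4 : ℝ) ^ n = 2 ^ n * 2 ^ n by rw [← mul_pow]; norm_num]
        ring
      rw [h6] at h5
      rw [pow_succ]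
      push_cast
      nlinarith

/-- The complementary products complete the denominators to `2 ^ n` at `u j` and, up to the factor
`‖q - u j‖`, to 2 at `q`. Splitting that factor by `htri` restores the missing factor at `a` or at
`b`, so that `IsLejaSection.prod_mul_prod_compl_le` absorbs one of the two numerators. -/
theorem IsLejaSection.prod_erase_div_le {n : ℕ} {u : ℕ → ℂ} (h : IsLejaSection u (2 ^ n))
    {m j : ℕ} (hm : m ≤ 2 ^ n) (hj : j < m) {a b q : ℂ} (ha : ‖a‖ = 1) (hb : ‖b‖ = 1)
    (hq : q ^ 2 ^ n = -1) (htri : ‖q - u j‖ ≤ ‖a - u j‖ + ‖b - u j‖) :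
    ∏ i ∈ (range m).erase j, (‖a - u i‖ * ‖b - u i‖) / (‖u j - u i‖ * ‖q - u i‖) ≤
      ((∏ i ∈ (range m).erase j, ‖a - u i‖) + ∏ i ∈ (range m).erase j, ‖b - u i‖) *
        ∏ i ∈ Ico m (2 ^ n), ‖q - u i‖ := by
  obtain ⟨k, hk⟩ := Nat.exists_eq_add_of_le hm
  have hnn : ∀ (z : ℂ) (s : Finset ℕ), 0 ≤ ∏ i ∈ s, ‖z - u i‖ :=
    fun z s => prod_nonneg fun _ _ => norm_nonneg _
  have hN : (0 : ℝ) < 2 ^ n := by positivity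
  have hIco : ∀ z : ℂ, ∏ i ∈ Ico m (2 ^ n), ‖z - u i‖ = ∏ i ∈ range k, ‖z - u (m + i)‖ :=
    fun z => by rw [prod_Ico_eq_prod_range, hk]; simp
  have h1 : (∏ i ∈ (range m).erase j, ‖u j - u i‖) * ∏ i ∈ Ico m (2 ^ n), ‖u j - u i‖ =
      2 ^ n := by
    rw [← h.prod_erase_self (hj.trans_le hm), hk,
      prod_range_add_erase_left (fun i => ‖u j - u i‖) hj, ← hk, hIco]
  have h2 : ‖q - u j‖ * (∏ i ∈ (range m).erase j, ‖q - u i‖) *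
      ∏ i ∈ Ico m (2 ^ n), ‖q - u i‖ = 2 := by
    rw [mul_prod_erase (range m) (fun i => ‖q - u i‖) (mem_range.2 hj),
      prod_range_mul_prod_Ico _ hm, h.prod_norm_sub, hq]
    norm_num
  have hP : ∀ z : ℂ, ‖z‖ = 1 → ‖z - u j‖ * (∏ i ∈ (range m).erase j, ‖z - u i‖) *
      ∏ i ∈ Ico m (2 ^ n), ‖u j - u i‖ ≤ 2 * 2 ^ n := fun z hz => by
    rw [mul_prod_erase (range m) (fun i => ‖z - u i‖) (mem_range.2 hj)]
    exact h.prod_mul_prod_compl_le hm hz (h.norm_eq_one (hj.trans_le hm))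
  have hPa := hP a ha
  have hPb := hP b hb
  rw [prod_div_distrib, prod_mul_distrib, prod_mul_distrib]
  have hA := hnn a ((range m).erase j)
  have hB := hnn b ((range m).erase j)
  have hU := hnn (u j) ((range m).erase j)
  have hQ := hnn q ((range m).erase j)
  have hRU := hnn (u j) (Ico m (2 ^ n))
  have hRQ := hnn q (Ico m (2 ^ n))
  generalize (∏ i ∈ (range m).erase j, ‖a - u i‖) = A at *
  generalize (∏ i ∈ (range m).erase j, ‖b - u i‖) = B at *
  generalize (∏ i ∈ (range m).erase j, ‖u j - u i‖) = U at *
  generalize (∏ i ∈ (range m).erase j, ‖q - u i‖) = Q at *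
  generalize (∏ i ∈ Ico m (2 ^ n), ‖u j - u i‖) = RU at *
  generalize (∏ i ∈ Ico m (2 ^ n), ‖q - u i‖) = RQ at *
  generalize ‖a - u j‖ = sa at *
  generalize ‖b - u j‖ = sb at *
  generalize ‖q - u j‖ = s at *
  have hU0 : 0 < U := hU.lt_of_ne (by rintro rfl; rw [zero_mul] at h1; linarith)
  have hQ0 : 0 < Q := hQ.lt_of_ne (by rintro rfl; rw [mul_zero, zero_mul] at h2; linarith)
  have hratio : A * B / (U * Q) = A * B * RU * RQ * s / (2 * 2 ^ n) := by
    rw [div_eq_div_iff (by positivity) (by positivity), ← h1, ← h2]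
    ring
  rw [hratio, div_le_iff₀ (by positivity)]
  calc A * B * RU * RQ * s ≤ A * B * RU * RQ * (sa + sb) := by gcongr
    _ = B * RQ * (sa * A * RU) + A * RQ * (sb * B * RU) := by ring
    _ ≤ B * RQ * (2 * 2 ^ n) + A * RQ * (2 * 2 ^ n) := by gcongr
    _ = (A + B) * RQ * (2 * 2 ^ n) := by ring

/-! ### From the circle to the interval. -/

/-- This is the identity writing a difference of cosines as a product of two sines, with the sines
read as chord lengths. -/
theorem Complex.abs_re_sub_re {z w : ℂ} (hz : ‖z‖ = 1) (hw : ‖w‖ = 1) :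
    |z.re - w.re| = ‖z - w‖ * ‖(starRingEnd ℂ) z - w‖ / 2 := by
  have hz2 : z.re * z.re + z.im * z.im = 1 := by
    rw [← Complex.normSq_apply, ← Complex.sq_norm, hz, one_pow]
  have hw2 : w.re * w.re + w.im * w.im = 1 := by
    rw [← Complex.normSq_apply, ← Complex.sq_norm, hw, one_pow]
  rw [← abs_of_nonneg (by positivity : 0 ≤ ‖z - w‖ * ‖(starRingEnd ℂ) z - w‖ / 2),
    ← sq_eq_sq_iff_abs_eq_abs, div_pow, mul_pow, Complex.sq_norm, Complex.sq_norm,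
    Complex.normSq_apply, Complex.normSq_apply]
  simp only [Complex.sub_re, Complex.sub_im, Complex.conj_re, Complex.conj_im]
  have h1 : (z.re - w.re) * (z.re - w.re) + (z.im - w.im) * (z.im - w.im) =
      2 - 2 * (z.re * w.re) - 2 * (z.im * w.im) := by linear_combination hz2 + hw2
  have h2 : (z.re - w.re) * (z.re - w.re) + (-z.im - w.im) * (-z.im - w.im) =
      2 - 2 * (z.re * w.re) + 2 * (z.im * w.im) := by linear_combination hz2 + hw2
  rw [h1, h2]
  linear_combination (1 - w.re * w.re) * hz2 + z.im * z.im * hw2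

theorem Complex.eq_or_eq_conj_of_re_eq {z w : ℂ} (hz : ‖z‖ = 1) (hw : ‖w‖ = 1)
    (h : z.re = w.re) : w = z ∨ w = (starRingEnd ℂ) z := by
  have := Complex.abs_re_sub_re hz hw
  rw [h, sub_self, abs_zero, eq_comm, div_eq_zero_iff, mul_eq_zero, norm_eq_zero,
    norm_eq_zero, sub_eq_zero, sub_eq_zero] at this
  rcases this with (h | h) | h
  · exact Or.inl h.symm
  · exact Or.inr h.symm
  · norm_num at h

/-- The Lebesgue constant is bounded by any bound for the Lebesgue function. -/
theorem lebesgueConstant_image_le {K : Set ℝ} [CompactSpace K] {m : ℕ} {y : ℕ → K}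
    (hy : Set.InjOn y (range m)) {C : ℝ} (hC : 0 ≤ C)
    (h : ∀ t ∈ K, ∑ j ∈ range m, ∏ i ∈ (range m).erase j,
      |t - (y i : ℝ)| / |(y j : ℝ) - (y i : ℝ)| ≤ C) :
    lebesgueConstant K ((range m).image y) ≤ C := by
  refine ContinuousLinearMap.opNorm_le_bound _ hC fun f => ?_
  refine (ContinuousMap.norm_le _ (by positivity)).2 fun t => ?_
  have hval : (lagrangeOperator K ((range m).image y) f) t = ∑ j ∈ range m, f (y j) *
      ∏ i ∈ (range m).erase j, ((y j : ℝ) - (y i : ℝ))⁻¹ * ((t : ℝ) - (y i : ℝ)) := by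
    unfold lagrangeOperator
    rw [_root_.sum_apply, ContinuousMap.sum_apply, sum_image hy]
    refine sum_congr rfl fun j hj => ?_
    have herase : ((range m).image y).erase (y j) = ((range m).erase j).image y := by
      ext b
      simp only [mem_erase, mem_image]
      constructor
      · rintro ⟨hb, i, hi, rfl⟩
        exact ⟨i, ⟨fun hij => hb (by rw [hij]), hi⟩, rfl⟩
      · rintro ⟨i, ⟨hij, hi⟩, rfl⟩
        exact ⟨fun heq => hij (hy hi hj heq), i, hi, rfl⟩
    simp only [ContinuousLinearMap.smulRight_apply, ContinuousMap.evalCLM_apply,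
      ContinuousMap.smul_apply, smul_eq_mul, Polynomial.toContinuousMapOn_apply,
      Polynomial.toContinuousMap_apply]
    rw [Lagrange.basis, herase, prod_image (hy.mono (by simp)),
      Polynomial.eval_prod]
    simp [Lagrange.basisDivisor]
  rw [hval, mul_comm]
  refine (norm_sum_le _ _).trans (le_trans ?_
    (mul_le_mul_of_nonneg_left (h t t.2) (norm_nonneg f)))
  rw [mul_sum]
  refine sum_le_sum fun j _ => ?_
  rw [norm_mul, norm_prod]
  refine mul_le_mul (f.norm_coe_le_norm _) (le_of_eq ?_)
    (prod_nonneg fun _ _ => norm_nonneg _) (norm_nonneg f)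
  refine prod_congr rfl fun i _ => ?_
  rw [norm_mul, norm_inv, Real.norm_eq_abs, Real.norm_eq_abs, div_eq_inv_mul]

/-! ### Positions of the new real parts. -/

/-- The position of a retained entry is the number of retained entries before it. -/
theorem StrictMono.apply_count {φ : ℕ → ℕ} (hφ : StrictMono φ) {p : ℕ → Prop} [DecidablePred p]
    (hrange : ∀ j, j ∈ Set.range φ ↔ p j) {a : ℕ} (ha : p a) : φ (Nat.count p a) = a := by
  obtain ⟨k, rfl⟩ := (hrange a).2 ha
  congr 1
  rw [Nat.count_eq_card_filter_range]
  have : (range (φ k)).filter p = (range k).image φ := by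
    ext j
    simp only [mem_filter, mem_range, mem_image]
    constructor
    · rintro ⟨hj, hpj⟩
      obtain ⟨i, rfl⟩ := (hrange j).2 hpj
      exact ⟨i, hφ.lt_iff_lt.1 hj, rfl⟩
    · rintro ⟨i, hi, rfl⟩
      exact ⟨hφ hi, (hrange _).1 ⟨i, rfl⟩⟩
  rw [this, card_image_of_injective _ hφ.injective, card_range]

theorem Complex.conj_eq_neg_of_sq_eq_neg_one {c : ℂ} (hc : c ^ 2 = -1) :
    (starRingEnd ℂ) c = -c := by
  have : (c - Complex.I) * (c + Complex.I) = 0 := by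
    linear_combination hc - Complex.I_sq
  rcases mul_eq_zero.1 this with h | h
  · rw [sub_eq_zero.1 h, Complex.conj_I]
  · rw [eq_neg_of_add_eq_zero_left h, map_neg, Complex.conj_I]

theorem sq_pow_eq_neg_one_of_pow {n : ℕ} {ρ : ℂ} (hρ : ρ ^ 2 ^ (n + 1) = -1) :
    (ρ ^ 2 ^ n) ^ 2 = -1 := by
  rw [← pow_mul, ← pow_succ, hρ]

/-- In the second half of a section of length `2 ^ (n + 2)`, the real parts of the first `2 ^ n`
points are new, and the other ones are repeated values. -/
theorem IsLejaSection.re_first_occurrence_iff {n : ℕ} {e : ℕ → ℂ}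
    (h : IsLejaSection e (2 ^ (n + 1 + 1))) {j : ℕ} (hj : j < 2 ^ (n + 1)) :
    (∀ i < 2 ^ (n + 1) + j, (e i).re ≠ (e (2 ^ (n + 1) + j)).re) ↔ j < 2 ^ n := by
  obtain ⟨ρ, u, hρ, hρM, hu, heu⟩ := h.second_half
  obtain ⟨σ, v, hσ, hσM, hv, huv⟩ := hu.second_half
  have hρ0 : ρ ≠ 0 := by rw [← norm_ne_zero_iff, hρ]; exact one_ne_zero
  have hM2 : 2 ^ (n + 1) = 2 ^ n + 2 ^ n := by ring
  have hM4 : 2 ^ (n + 1 + 1) = 2 ^ (n + 1) + 2 ^ (n + 1) := by ring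
  -- Here `c` is `I` or `-I`. The `2 ^ n`-th powers of the points are `c` in the first batch of `2 ^
  -- n` and `-c` in the second, and conjugation swaps the two values.
  set c := ρ ^ 2 ^ n with hc
  have hc2 : c ^ 2 = -1 := sq_pow_eq_neg_one_of_pow hρM
  have hconj := Complex.conj_eq_neg_of_sq_eq_neg_one hc2
  have hc0 : c ≠ 0 := pow_ne_zero _ hρ0
  have hnc : -c ≠ c := fun hh => hc0 (self_eq_neg.1 hh.symm)
  have hfst : ∀ i < 2 ^ n, e (2 ^ (n + 1) + i) ^ 2 ^ n = c := fun i hi => by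
    rw [heu, mul_pow, hu.first_half.pow_eq_one hi, mul_one]
  have hsnd : ∀ i < 2 ^ n, e (2 ^ (n + 1) + (2 ^ n + i)) ^ 2 ^ n = -c := fun i hi => by
    rw [heu, huv, mul_pow, mul_pow, hσM, hv.pow_eq_one hi, mul_one, mul_neg_one]
  have hnorm : ∀ i < 2 ^ (n + 1 + 1), ‖e i‖ = 1 := fun i hi => h.norm_eq_one hi
  constructor
  · intro hnew
    by_contra hlt
    obtain ⟨k, rfl⟩ := Nat.exists_eq_add_of_le (not_lt.1 hlt)
    have hk : k < 2 ^ n := by omega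
    set w := e (2 ^ (n + 1) + (2 ^ n + k)) with hw
    -- The conjugate of a second-batch point, divided by `ρ`, is a `2 ^ n`-th root of unity, so that
    -- conjugate already occurred in the first batch.
    have hroot : ((starRingEnd ℂ) w / ρ) ^ 2 ^ n = 1 := by
      rw [div_pow, ← map_pow, hsnd k hk, map_neg, hconj, neg_neg, div_self hc0]
    have hprod := hu.first_half.prod_sub ((starRingEnd ℂ) w / ρ)
    rw [hroot, sub_self, prod_eq_zero_iff] at hprod
    obtain ⟨i, hi, hzero⟩ := hprod
    have hi := mem_range.1 hi
    refine hnew (2 ^ (n + 1) + i) (by omega) ?_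
    rw [heu, ← sub_eq_zero.1 hzero, mul_div_cancel₀ _ hρ0, Complex.conj_re]
  · intro hjn i hi hre
    have hei : ‖e i‖ = 1 := hnorm i (by omega)
    rcases Complex.eq_or_eq_conj_of_re_eq (hnorm (2 ^ (n + 1) + j) (by omega)) hei hre.symm with
      heq | heq
    · exact hi.ne (h.injOn (mem_coe.2 (mem_range.2 (by omega)))
        (mem_coe.2 (mem_range.2 (by omega))) heq)
    · have h1 : e i ^ 2 ^ n = -c := by rw [heq, ← map_pow, hfst j hjn, hconj]
      -- A conjugate has `2 ^ n`-th power `-c`, whose square is `-1`. Points before `2 ^ (n + 1)`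
      -- have square 1 there, and first-batch points have power `c`.
      rcases lt_or_ge i (2 ^ (n + 1)) with hlt | hge
      · have h2 := h.first_half.pow_eq_one hlt
        rw [pow_succ, pow_mul, h1, neg_sq, hc2] at h2
        norm_num at h2
      · obtain ⟨k, rfl⟩ := Nat.exists_eq_add_of_le hge
        rw [hfst k (by omega)] at h1
        exact hnc h1.symm

-- The points 1 and -1 give two values, and each doubling of the length from `2 ^ (n + 1)` adds `2 ^
-- n` new ones.
open Classical in
theorem IsLejaSequence.count_re_first_occurrence {e : ℕ → ℂ} (h : IsLejaSequence e) (n : ℕ) :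
    Nat.count (fun j => ∀ i < j, (e i).re ≠ (e j).re) (2 ^ (n + 1)) = 2 ^ n + 1 := by
  induction n with
  | zero =>
    obtain ⟨ρ, u, -, hρ, hu, heu⟩ := (h.isLejaSection (2 ^ (0 + 1))).second_half
    have h1 : e 1 = -1 := by
      have := heu 0
      rw [hu.1, mul_one] at this
      simpa [hρ] using this.trans (by simpa using hρ)
    refine Nat.count_iff_forall.2 fun j hj => ?_
    intro i hij
    obtain ⟨rfl, rfl⟩ : i = 0 ∧ j = 1 := by omega
    rw [h.1, h1]
    norm_num
  | succ n ih =>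
    have key : ∀ j < 2 ^ (n + 1), _ :=
      fun j hj => (h.isLejaSection (2 ^ (n + 1 + 1))).re_first_occurrence_iff hj
    have hM2 : 2 ^ (n + 1) = 2 ^ n + 2 ^ n := by ring
    rw [show 2 ^ (n + 1 + 1) = 2 ^ (n + 1) + (2 ^ n + 2 ^ n) by ring, Nat.count_add, ih,
      Nat.count_add, Nat.count_iff_forall.2 fun j hj => (key j (by omega)).2 hj,
      Nat.count_iff_forall_not.2 fun j hj hp => by
        have := (key (2 ^ n + j) (by omega)).1 hp
        omega]
    omega

/-- The entries of an `ℜ`-Leja sequence following the first `2 ^ n + 1` ones are the real parts of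
consecutive entries of the underlying Leja sequence. -/
theorem IsLejaSequence.dedup_re_apply {e : ℕ → ℂ} (h : IsLejaSequence e) {x : ℕ → ℝ}
    (hx : IsDedup (fun k => (e k).re) x) {n j : ℕ} (hj : j < 2 ^ n) :
    x (2 ^ n + 1 + j) = (e (2 ^ (n + 1) + j)).re := by
  classical
  obtain ⟨φ, hφ, hrange, hxφ⟩ := hx
  have hM2 : 2 ^ (n + 1) = 2 ^ n + 2 ^ n := by ring
  have key : ∀ j < 2 ^ (n + 1), _ :=
    fun j hj => (h.isLejaSection (2 ^ (n + 1 + 1))).re_first_occurrence_iff hj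
  have hcount : Nat.count (fun j => ∀ i < j, (e i).re ≠ (e j).re) (2 ^ (n + 1) + j) =
      2 ^ n + 1 + j := by
    rw [Nat.count_add, h.count_re_first_occurrence,
      Nat.count_iff_forall.2 fun i hi => (key i (by omega)).2 (by omega)]
  have := hφ.apply_count (p := fun j => ∀ i < j, (e i).re ≠ (e j).re)
    (fun j => by rw [hrange]; rfl) ((key j (by omega)).2 hj)
  rw [hcount] at this
  rw [hxφ, this]

/-! ### The final estimate. -/

/-- The Lebesgue function of the real parts of the first `m` points of a rotated section. -/
theorem IsLejaSection.sum_prod_abs_div_le {n : ℕ} {u : ℕ → ℂ} (h : IsLejaSection u (2 ^ n))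
    {ρ : ℂ} (hρ : ‖ρ‖ = 1) (hρM : ρ ^ 2 ^ (n + 1) = -1) {m : ℕ} (hm : m ≤ 2 ^ n) {t : ℝ}
    (ht : t ∈ Set.Icc (-1 : ℝ) 1) :
    ∑ j ∈ range m, ∏ i ∈ (range m).erase j,
      |t - (ρ * u i).re| / |(ρ * u j).re - (ρ * u i).re| ≤ 2 * (4 ^ n * (3 + n)) := by
  have hρ0 : ρ ≠ 0 := by rw [← norm_ne_zero_iff, hρ]; exact one_ne_zero
  have hdiv : ∀ {z : ℂ}, ‖z‖ = 1 → ‖z / ρ‖ = 1 := fun hz => by rw [norm_div, hz, hρ, div_one]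
  obtain ⟨z, hz, hzt⟩ : ∃ z : ℂ, ‖z‖ = 1 ∧ z.re = t :=
    ⟨Complex.exp (Real.arccos t * Complex.I), Complex.norm_exp_ofReal_mul_I _, by
      rw [Complex.exp_ofReal_mul_I_re, Real.cos_arccos ht.1 ht.2]⟩
  set cz := (starRingEnd ℂ) z with hcz
  have hcz1 : ‖cz‖ = 1 := by rw [hcz, Complex.norm_conj, hz]
  have hwn : ∀ j < 2 ^ n, ‖ρ * u j‖ = 1 := fun j hj => by
    rw [norm_mul, hρ, h.norm_eq_one hj, one_mul]
  have hsub : ∀ (y : ℂ) (i : ℕ), ‖y - ρ * u i‖ = ‖y / ρ - u i‖ := fun y i => by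
    rw [← mul_div_cancel₀ y hρ0, ← mul_sub, norm_mul, hρ, one_mul, mul_div_cancel₀ y hρ0]
  -- The conjugate of the `j`-th node, rotated back; its `2 ^ n`-th power is `-1`, so it stays off
  -- the section.
  set q : ℕ → ℂ := fun j => (starRingEnd ℂ) (ρ * u j) / ρ with hq
  have habs : ∀ {y : ℂ}, ‖y‖ = 1 → ∀ i < 2 ^ n, |y.re - (ρ * u i).re| =
      ‖y / ρ - u i‖ * ‖(starRingEnd ℂ) y / ρ - u i‖ / 2 := fun hy i hi => by
    rw [Complex.abs_re_sub_re hy (hwn i hi), hsub, hsub]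
  have hterm : ∀ j ∈ range m, ∏ i ∈ (range m).erase j,
      |t - (ρ * u i).re| / |(ρ * u j).re - (ρ * u i).re| ≤
        ((∏ i ∈ (range m).erase j, ‖z / ρ - u i‖) + ∏ i ∈ (range m).erase j, ‖cz / ρ - u i‖) *
          ∏ i ∈ Ico m (2 ^ n), ‖q j - u i‖ := fun j hj => by
    have hjm := mem_range.1 hj
    have hjN := hjm.trans_le hm
    have hqM : q j ^ 2 ^ n = -1 := by
      rw [hq, div_pow, ← map_pow, mul_pow, h.pow_eq_one hjN, mul_one,
        Complex.conj_eq_neg_of_sq_eq_neg_one (sq_pow_eq_neg_one_of_pow hρM), neg_div,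
        div_self (pow_ne_zero _ hρ0)]
    have htri : ‖q j - u j‖ ≤ ‖z / ρ - u j‖ + ‖cz / ρ - u j‖ := by
      rw [hq, ← hsub, ← hsub, ← hsub]
      have h1 := norm_sub_le_norm_sub_add_norm_sub ((starRingEnd ℂ) (ρ * u j)) cz (ρ * u j)
      rw [hcz, ← map_sub, Complex.norm_conj, norm_sub_rev (ρ * u j) z] at h1
      exact h1
    refine le_trans (le_of_eq (prod_congr rfl fun i hi => ?_))
      (h.prod_erase_div_le hm hjm (hdiv hz) (hdiv hcz1) hqM htri)
    have hiN : i < 2 ^ n := (mem_range.1 (mem_of_mem_erase hi)).trans_le hm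
    rw [← hzt, habs hz i hiN, habs (hwn j hjN) i hiN, mul_div_cancel_left₀ _ hρ0,
      div_div_div_cancel_right₀ two_ne_zero]
  refine (sum_le_sum hterm).trans ?_
  simp only [add_mul, sum_add_distrib]
  -- The value 1 is a filler: the sum estimate asks for unit norm at every index, while `q j` is
  -- controlled only for `j < 2 ^ n`.
  have hy : ∀ j, ‖(if j < 2 ^ n then q j else 1)‖ = 1 := fun j => by
    split_ifs with hj
    · exact hdiv (by rw [Complex.norm_conj, hwn j hj])
    · exact norm_one
  have hfin : ∀ y : ℂ, ‖y‖ = 1 → ∑ j ∈ range m, (∏ i ∈ (range m).erase j, ‖y - u i‖) *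
      ∏ i ∈ Ico m (2 ^ n), ‖q j - u i‖ ≤ 4 ^ n * (3 + n) := fun y hy1 => by
    refine le_trans (le_of_eq (sum_congr rfl fun j hj => ?_))
      (h.sum_prod_erase_mul_prod_compl_le hm hy1 hy)
    rw [if_pos ((mem_range.1 hj).trans_le hm)]
  linarith [hfin _ (hdiv hz), hfin _ (hdiv hcz1)]

theorem theorem4p3 :
    ∃ M' : ℝ, ∀ x : ℕ → Set.Icc (-1 : ℝ) 1, IsReLejaSequence x →
      ∀ n k : ℕ, 2 ^ n + 1 < k → k ≤ 2 ^ (n + 1) →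
        lebesgueConstant (Set.Icc (-1 : ℝ) 1) (tupleSet x (2 ^ n + 1) (k - 1)) ≤
          M' * (2 : ℝ) ^ (2 * n) * Real.log ((2 : ℝ) ^ n) := by
  -- For `n ≥ 1`, `2 * (3 + n) ≤ 8 * n`; dividing by `Real.log 2` turns `n` into `Real.log (2 ^ n)`.
  refine ⟨8 / Real.log 2, fun x hx n k hnk hk => ?_⟩
  obtain ⟨e, he, hdedup⟩ := hx
  have hM2 : 2 ^ (n + 1) = 2 ^ n + 2 ^ n := by ring
  obtain ⟨ρ, u, hρ, hρM, hu, heu⟩ := (he.isLejaSection (2 ^ (n + 1 + 1))).second_half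
  have hn1 : 1 ≤ n := by
    by_contra h0
    obtain rfl : n = 0 := by omega
    omega
  obtain ⟨m, rfl⟩ : ∃ m, k = 2 ^ n + 1 + m := Nat.exists_eq_add_of_le hnk.le
  have hm : m ≤ 2 ^ n := by omega
  have hxe : ∀ j < m, (x (2 ^ n + 1 + j) : ℝ) = (ρ * u j).re := fun j hj => by
    rw [he.dedup_re_apply hdedup (hj.trans_le hm), heu]
  have hset : tupleSet x (2 ^ n + 1) (2 ^ n + 1 + m - 1) =
      (range m).image fun j => x (2 ^ n + 1 + j) := by
    ext y
    simp only [tupleSet, mem_image, mem_Icc, mem_range]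
    constructor
    · rintro ⟨i, hi, rfl⟩
      exact ⟨i - (2 ^ n + 1), by omega, by rw [show 2 ^ n + 1 + (i - (2 ^ n + 1)) = i by omega]⟩
    · rintro ⟨i, hi, rfl⟩
      exact ⟨2 ^ n + 1 + i, by omega, rfl⟩
  have hinj : Set.InjOn (fun j => x (2 ^ n + 1 + j)) (range m) := by
    intro i hi j hj hij
    have hi' := mem_range.1 (mem_coe.1 hi)
    have hj' := mem_range.1 (mem_coe.1 hj)
    have hre : (e (2 ^ (n + 1) + i)).re = (e (2 ^ (n + 1) + j)).re := by
      rw [heu, heu, ← hxe i hi', ← hxe j hj']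
      exact congrArg Subtype.val hij
    have key : ∀ j < 2 ^ (n + 1), _ :=
      fun j hj => (he.isLejaSection (2 ^ (n + 1 + 1))).re_first_occurrence_iff hj
    rcases lt_trichotomy i j with h | h | h
    · exact absurd hre ((key j (by omega)).2 (by omega) _ (by omega))
    · exact h
    · exact absurd hre.symm ((key i (by omega)).2 (by omega) _ (by omega))
  have hlog2 : 0 < Real.log 2 := Real.log_pos (by norm_num)
  have hbound : 2 * ((4 : ℝ) ^ n * (3 + n)) ≤
      8 / Real.log 2 * (2 : ℝ) ^ (2 * n) * Real.log ((2 : ℝ) ^ n) := by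
    rw [Real.log_pow, pow_mul, show (2 : ℝ) ^ 2 = 4 by norm_num]
    have h1 : 8 / Real.log 2 * 4 ^ n * (n * Real.log 2) = 4 ^ n * (8 * n) := by field_simp
    have h2 : (1 : ℝ) ≤ n := by exact_mod_cast hn1
    have h4 : (0 : ℝ) < 4 ^ n := by positivity
    rw [h1]
    nlinarith
  rw [hset]
  refine (lebesgueConstant_image_le hinj (by positivity) fun t ht => ?_).trans hbound
  refine le_trans (le_of_eq (sum_congr rfl fun j hj => prod_congr rfl fun i hi => ?_))
    (hu.first_half.sum_prod_abs_div_le hρ hρM hm ht)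
  rw [hxe j (mem_range.1 hj), hxe i (mem_range.1 (mem_of_mem_erase hi))]
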